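/- Let $N$ be a countably infinite set. An almost disjoint family over $N$ is an infinite collection $\mathcal A$ of infinite subsets of $N$ such that $a\cap b$ is finite for all distinct $a,b\in\mathcal A$. Its Isbell–Mrówka space $\Psi(\mathcal A)$ is the disjoint union $N\sqcup\mathcal A$ with the topology generated by the sets $\{n\}$ ($n\in N$) and $\{a\}\cup(a\setminus F)$ ($a\in\mathcal A$, $F\subseteq N$ finite). The family $\mathcal A$ is called semi-normal if for every closed set $K\subseteq\Psi(\mathcal A)$ and every open set $U\supseteq K$ there is a regular open set $V$ (that is, $V=\operatorname{int}(\operatorname{cl}(V))$) with $K\subseteq V\subseteq U$. Let $\operatorname{add}(\mathcal M)$ be the least cardinality of a collection of meager subsets of $\mathbb R$ whose union is not meager. If $\operatorname{add}(\mathcal M)=\omega_1$, then there is an almost disjoint family over $N$ of cardinality $\omega_1$ that is not semi-normal. -/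

import Mathlib

open scoped Cardinal

universe u

/-- An almost disjoint family over `N`: an infinite collection of infinite subsets of `N`, any two
distinct members of which have finite intersection. -/
structure IsAlmostDisjointFamily {N : Type u} (A : Set (Set N)) : Prop where
  infinite : A.Infinite
  infinite_of_mem : ∀ a ∈ A, a.Infinite
  finite_inter : ∀ a ∈ A, ∀ b ∈ A, a ≠ b → (a ∩ b).Finite

/-- The underlying set of the Isbell-Mrówka space of `A`: the disjoint union of `N` and `A`. -/
inductive PsiSpace {N : Type u} (A : Set (Set N)) : Type u
  | point (n : N) : PsiSpace A
  | member (a : A) : PsiSpace A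

/-- The topology of the Isbell-Mrówka space, generated by the singletons `{n}`, `n ∈ N`, and the
sets `{a} ∪ (a \ F)` with `a ∈ A` and `F` a finite subset of `N`. -/
instance PsiSpace.instTopologicalSpace {N : Type u} (A : Set (Set N)) :
    TopologicalSpace (PsiSpace A) :=
  TopologicalSpace.generateFrom
    ({S | ∃ n : N, S = {PsiSpace.point n}} ∪
      {S | ∃ (a : A) (F : Set N), F.Finite ∧
        S = {PsiSpace.member a} ∪ PsiSpace.point '' ((a : Set N) \ F)})

/-- A regular open set: one that is equal to the interior of its closure. -/
def IsRegularOpenSet {X : Type u} [TopologicalSpace X] (V : Set X) : Prop :=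
  V = interior (closure V)

/-- A semi-normal space: every open set around a closed set contains a regular open set around that
closed set. -/
def IsSemiNormal (X : Type u) [TopologicalSpace X] : Prop :=
  ∀ F U : Set X, IsClosed F → IsOpen U → F ⊆ U →
    ∃ V : Set X, IsRegularOpenSet V ∧ F ⊆ V ∧ V ⊆ U

/-- The additivity of the meagre ideal: the least cardinality of a collection of meagre subsets of
`ℝ` whose union is not meagre. -/
noncomputable def addMeagre : Cardinal.{0} :=
  sInf {κ | ∃ S : Set (Set ℝ), (∀ s ∈ S, IsMeagre s) ∧ ¬ IsMeagre (⋃₀ S) ∧ #S = κ}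

open Set Filter Topology

namespace PsiSpace

variable {N : Type u} {A : Set (Set N)}

theorem isOpen_iff {V : Set (PsiSpace A)} :
    IsOpen V ↔ ∀ a : A, member a ∈ V → ((a : Set N) \ {n | point n ∈ V}).Finite := by
  constructor
  · intro hV
    induction hV with
    | basic s hs =>
      rintro a ha
      rcases hs with ⟨n, rfl⟩ | ⟨b, F, hF, rfl⟩
      · simp at ha
      · have hab : a = b := by simpa using ha
        subst hab
        refine hF.subset fun n hn => ?_
        by_contra hnF
        exact hn.2 (Or.inr ⟨n, ⟨hn.1, hnF⟩, rfl⟩)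
    | univ => simp
    | inter s t _ _ ihs iht =>
      intro a ha
      refine ((ihs a ha.1).union (iht a ha.2)).subset fun n hn => ?_
      by_cases h : point n ∈ s
      · exact Or.inr ⟨hn.1, fun h' => hn.2 ⟨h, h'⟩⟩
      · exact Or.inl ⟨hn.1, h⟩
    | sUnion S _ ih =>
      rintro a ⟨s, hs, ha⟩
      exact (ih s hs a ha).subset fun n hn => ⟨hn.1, fun h => hn.2 ⟨s, hs, h⟩⟩
  · intro h
    rw [isOpen_iff_forall_mem_open]
    rintro (n | a) hx
    · exact ⟨{point n}, by simpa using hx,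
        TopologicalSpace.isOpen_generateFrom_of_mem (Or.inl ⟨n, rfl⟩), rfl⟩
    · refine ⟨{member a} ∪ point '' ((a : Set N) \ ((a : Set N) \ {n | point n ∈ V})), ?_,
        TopologicalSpace.isOpen_generateFrom_of_mem (Or.inr ⟨a, _, h a hx, rfl⟩), Or.inl rfl⟩
      rintro _ (rfl | ⟨n, hn, rfl⟩)
      · exact hx
      · by_contra hV
        exact hn.2 ⟨hn.1, hV⟩

/-- In a semi-normal Isbell-Mrówka space, every subfamily is weakly separated from its
complement. -/
theorem exists_inter_finite_iff (hA : ∀ a ∈ A, a.Infinite) (h : IsSemiNormal (PsiSpace A))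
    (B : Set (Set N)) : ∃ M : Set N, ∀ a ∈ A, (a ∩ M).Finite ↔ a ∈ B := by
  obtain ⟨V, hV, hFV, hVU⟩ := h {p | ∃ a : A, (a : Set N) ∈ B ∧ p = member a}
    {p | ∀ a : A, p = member a → (a : Set N) ∈ B}
    (by
      rw [← isOpen_compl_iff, isOpen_iff]
      intro a _
      convert Set.finite_empty
      ext n
      simp)
    (by
      rw [isOpen_iff]
      intro a _
      convert Set.finite_empty
      ext n
      simp)
    (by
      rintro _ ⟨a, ha, rfl⟩ b hb
      cases hb
      exact ha)
  have hVo : IsOpen V := by rw [hV]; exact isOpen_interior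
  refine ⟨{n | point n ∈ V}ᶜ, fun a ha => ⟨fun hfin => ?_, fun haB => ?_⟩⟩
  · have hfin' : (a \ {n | point n ∈ V}).Finite := hfin
    refine hVU (a := member ⟨a, ha⟩) ?_ ⟨a, ha⟩ rfl
    rw [hV, mem_interior]
    refine ⟨V ∪ {member ⟨a, ha⟩}, ?_, ?_, Or.inr rfl⟩
    · rintro p (hp | rfl)
      · exact subset_closure hp
      · rw [mem_closure_iff]
        intro O hO haO
        have := (hA a ha).sdiff (hfin'.union (isOpen_iff.1 hO _ haO))
        obtain ⟨n, hna, hn⟩ := this.nonempty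
        refine ⟨point n, ?_, ?_⟩
        · by_contra hc
          exact hn (Or.inr ⟨hna, hc⟩)
        · by_contra hc
          exact hn (Or.inl ⟨hna, hc⟩)
    · rw [isOpen_iff]
      rintro b hb
      have : ((b : Set N) \ {n | point n ∈ V}).Finite := by
        rcases hb with hb | hb
        · exact isOpen_iff.1 hVo b hb
        · cases hb
          exact hfin'
      exact this.subset fun n hn => ⟨hn.1, fun h => hn.2 (Or.inl h)⟩
  · exact isOpen_iff.1 hVo ⟨a, ha⟩ (hFV ⟨⟨a, ha⟩, haB, rfl⟩)

end PsiSpace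

/-- Every almost disjoint family of cardinality `ℵ₁` over `N` is semi-normal. -/
def AllSemiNormal (N : Type u) : Prop :=
  ∀ A : Set (Set N), IsAlmostDisjointFamily A → #A = Cardinal.aleph 1 → IsSemiNormal (PsiSpace A)

section Separation

variable {N : Type u} [Countable N] [Infinite N] {ι κ : Type}

theorem AllSemiNormal.exists_weak_separation (hN : AllSemiNormal N)
    (hι : #ι = Cardinal.aleph 1) (hκ : #κ ≤ Cardinal.aleph 1)
    (b : ι → Set (ℕ × ℕ)) (c : κ → Set (ℕ × ℕ))
    (hb : ∀ α, (b α).Infinite) (hc : ∀ β, (c β).Infinite)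
    (hbb : ∀ α α', α ≠ α' → (b α ∩ b α').Finite) (hcc : ∀ β β', β ≠ β' → (c β ∩ c β').Finite)
    (hbc : ∀ α β, (b α ∩ c β).Finite) :
    ∃ M : Set (ℕ × ℕ), (∀ α, (b α ∩ M).Finite) ∧ ∀ β, (c β ∩ M).Infinite := by
  obtain ⟨e⟩ : Nonempty (ℕ × ℕ ≃ N) := nonempty_equiv_of_countable
  have he := e.injective
  let f : ι ⊕ κ → Set N := fun x => e '' Sum.elim b c x
  have hinf : ∀ x, (f x).Infinite := by
    rintro (α | β)
    · exact (hb α).image he.injOn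
    · exact (hc β).image he.injOn
  have hfin : ∀ x y, x ≠ y → (f x ∩ f y).Finite := by
    intro x y hxy
    simp only [f]
    rw [← image_inter he]
    refine Finite.image _ ?_
    rcases x with α | β <;> rcases y with α' | β'
    · exact hbb _ _ fun h => hxy (by rw [h])
    · exact hbc _ _
    · exact inter_comm (b α') (c β) ▸ hbc _ _
    · exact hcc _ _ fun h => hxy (by rw [h])
  have hinj : Function.Injective f := by
    intro x y hxy
    by_contra hne
    have := hfin x y hne
    rw [hxy, inter_self] at this
    exact hinf y this
  have hcard : #(ι ⊕ κ) = Cardinal.aleph 1 := by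
    rw [Cardinal.mk_sum, Cardinal.lift_id, Cardinal.lift_id, hι]
    exact Cardinal.add_eq_left (Cardinal.aleph0_le_aleph 1) hκ
  have hI : Infinite (ι ⊕ κ) := by
    rw [Cardinal.infinite_iff, hcard]
    exact Cardinal.aleph0_le_aleph 1
  have hAD : IsAlmostDisjointFamily (range f) :=
    { infinite := infinite_range_of_injective hinj
      infinite_of_mem := by
        rintro _ ⟨x, rfl⟩
        exact hinf x
      finite_inter := by
        rintro _ ⟨x, rfl⟩ _ ⟨y, rfl⟩ hxy
        exact hfin x y fun h => hxy (by rw [h]) }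
  have hA1 : #(range f) = Cardinal.aleph 1 := by
    have := Cardinal.mk_range_eq_of_injective hinj
    rw [hcard] at this
    simpa using this
  obtain ⟨M, hM⟩ := PsiSpace.exists_inter_finite_iff hAD.infinite_of_mem (hN _ hAD hA1)
    (range (f ∘ Sum.inl))
  have key : ∀ x, (f x ∩ M).Finite ↔ (Sum.elim b c x ∩ e ⁻¹' M).Finite := by
    intro x
    rw [← finite_image_iff he.injOn, image_inter_preimage]
  refine ⟨e ⁻¹' M, fun α => ?_, fun β hβ => ?_⟩
  · exact (key (Sum.inl α)).1 ((hM _ (mem_range_self _)).2 ⟨α, rfl⟩)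
  · obtain ⟨α, hα⟩ := (hM _ (mem_range_self (Sum.inr β))).1 ((key (Sum.inr β)).2 hβ)
    cases hinj hα

/-- An almost disjoint family of branches of the binary tree, with nodes numbered as in a heap. -/
theorem exists_branches (hι : #ι = Cardinal.aleph 1) :
    ∃ y : ι → ℕ → ℕ, (∀ α k, 2 ^ k ≤ y α k) ∧ (∀ α k, y α k < 2 ^ (k + 1)) ∧
      ∀ α β, α ≠ β → {k | y α k = y β k}.Finite := by
  have hle : #ι ≤ #(ℕ → Bool) := by
    rw [hι]
    simpa using Cardinal.aleph_one_le_continuum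
  obtain ⟨f⟩ := hle
  let y : ι → ℕ → ℕ := fun α k => Nat.rec 1 (fun n r => 2 * r + (f α n).toNat) k
  have hy : ∀ α k, y α (k + 1) = 2 * y α k + (f α k).toNat := fun α k => rfl
  refine ⟨y, fun α k => ?_, fun α k => ?_, fun α β hαβ => ?_⟩
  · induction k with
    | zero => simp [y]
    | succ k ih => rw [hy, pow_succ]; omega
  · induction k with
    | zero => simp [y]
    | succ k ih =>
      rw [hy, pow_succ]
      have := Bool.toNat_le (f α k)
      omega
  · obtain ⟨n, hn⟩ : ∃ n, f α n ≠ f β n := by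
      by_contra! h
      exact hαβ (f.injective (funext h))
    have hstep : ∀ k, y α (k + 1) = y β (k + 1) → y α k = y β k ∧ f α k = f β k := by
      intro k hk
      rw [hy, hy] at hk
      cases hα : f α k <;> cases hβ : f β k <;> simp [hα, hβ] at hk ⊢ <;> omega
    have hne : ∀ k, n < k → y α k ≠ y β k := by
      intro k hk
      induction k, hk using Nat.le_induction with
      | base => exact fun h => hn (hstep n h).2
      | succ k _ ih => exact fun h => ih (hstep k h).1
    exact (finite_le_nat n).subset fun k hk => not_lt.1 fun h => hne k h hk

theorem level_unique {y : ι → ℕ → ℕ} (hy : ∀ α k, 2 ^ k ≤ y α k)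
    (hy' : ∀ α k, y α k < 2 ^ (k + 1)) {α β : ι} {k l : ℕ} (h : y α k = y β l) : k = l := by
  have h1 := (hy α k).trans_lt (h ▸ hy' β l)
  have h2 := (hy β l).trans_lt (h ▸ hy' α k)
  rw [Nat.pow_lt_pow_iff_right (by norm_num)] at h1 h2
  omega

theorem AllSemiNormal.exists_bound (hN : AllSemiNormal N) (hι : #ι = Cardinal.aleph 1)
    (v : ι → ℕ → ℕ) : ∃ g : ℕ → ℕ, ∀ α, ∀ᶠ k in atTop, v α k ≤ g k := by
  obtain ⟨y, hy, hy', hyf⟩ := exists_branches hι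
  have hinj : ∀ {α β k l}, y α k = y β l → k = l := fun h => level_unique hy hy' h
  obtain ⟨M, hMb, hMc⟩ := hN.exists_weak_separation (κ := ℕ) hι
    (by rw [Cardinal.mk_nat]; exact Cardinal.aleph0_le_aleph 1)
    (fun α => {p | ∃ k, p.1 = y α k ∧ p.2 ≤ v α k}) (fun j => {p | p.1 = j})
    (fun α => by
      refine (infinite_range_of_injective (f := fun k => (y α k, 0)) ?_).mono ?_
      · intro k l h
        exact hinj (Prod.mk.inj h).1
      · rintro _ ⟨k, rfl⟩
        exact ⟨k, rfl, Nat.zero_le _⟩)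
    (fun j => by
      refine (infinite_range_of_injective (f := fun k : ℕ => (j, k)) ?_).mono ?_
      · intro k l h
        exact (Prod.mk.inj h).2
      · rintro _ ⟨k, rfl⟩
        rfl)
    (fun α β hαβ => by
      refine ((hyf α β hαβ).biUnion (t := fun k => {y α k} ×ˢ Iic (v α k))
        fun k _ => (finite_singleton _).prod (finite_Iic _)).subset ?_
      rintro ⟨j, i⟩ ⟨⟨k, hk, hi⟩, l, hl, -⟩
      dsimp only at hk hl hi
      obtain rfl : k = l := hinj (hk.symm.trans hl)
      exact mem_biUnion (x := k) (show _ = _ from hk.symm.trans hl) ⟨hk, hi⟩)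
    (fun j j' hj => by
      convert finite_empty
      ext p
      simp only [mem_inter_iff, mem_ofPred_eq, mem_empty_iff_false, iff_false]
      rintro ⟨rfl, h⟩
      exact hj h)
    (fun α j => by
      by_cases h : ∃ k, j = y α k
      · obtain ⟨k, rfl⟩ := h
        refine ((finite_singleton (y α k)).prod (finite_Iic (v α k))).subset ?_
        rintro ⟨j, i⟩ ⟨⟨l, hl, hi⟩, hj⟩
        dsimp only at hl hi
        have hj' : j = y α k := hj
        obtain rfl : l = k := hinj (hl.symm.trans hj')
        exact ⟨hj', hi⟩
      · convert finite_empty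
        ext p
        simp only [mem_inter_iff, mem_ofPred_eq, mem_empty_iff_false, iff_false]
        rintro ⟨⟨k, hk, -⟩, rfl⟩
        exact h ⟨k, hk⟩)
  have hG : ∀ j, ∃ i, (j, i) ∈ M := by
    intro j
    obtain ⟨⟨j', i⟩, hj, hM⟩ := (hMc j).nonempty
    obtain rfl : j' = j := hj
    exact ⟨i, hM⟩
  choose G hG using hG
  refine ⟨fun k => (Finset.range (2 ^ (k + 1))).sup G, fun α => ?_⟩
  have hfin : {k | G (y α k) ≤ v α k}.Finite := by
    refine Finite.of_finite_image (f := fun k => (y α k, G (y α k)))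
      ((hMb α).subset ?_) (fun k _ l _ h => hinj (Prod.mk.inj h).1)
    rintro _ ⟨k, hk, rfl⟩
    exact ⟨⟨k, rfl, hk⟩, hG _⟩
  have := hfin.eventually_cofinite_notMem
  rw [Nat.cofinite_eq_atTop] at this
  filter_upwards [this] with k hk
  exact (not_le.1 hk).le.trans (Finset.le_sup (f := G) (Finset.mem_range.2 (hy' α k)))

theorem AllSemiNormal.exists_frequently_eq (hN : AllSemiNormal N) (hι : #ι = Cardinal.aleph 1)
    (v : ι → ℕ → ℕ) : ∃ p : ℕ → ℕ, ∀ α, ∃ᶠ j in atTop, p j = v α j := by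
  obtain ⟨y, hy, hy', hyf⟩ := exists_branches hι
  have hinj : ∀ {α β k l}, y α k = y β l → k = l := fun h => level_unique hy hy' h
  have hyt : ∀ α, Tendsto (y α) atTop atTop := fun α =>
    tendsto_atTop_mono (fun k => (Nat.lt_two_pow_self (n := k)).le.trans (hy α k)) tendsto_id
  obtain ⟨g, hg⟩ := hN.exists_bound hι v
  obtain ⟨M, hMb, hMc⟩ := hN.exists_weak_separation (κ := ι) hι hι.le
    (fun α => {p | ∃ k, p.1 = y α k ∧ p.2 ≤ g p.1 + 1 ∧ p.2 ≠ v α p.1})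
    (fun α => {p | ∃ k, p.1 = y α k ∧ p.2 = v α p.1})
    (fun α => by
      refine (infinite_range_of_injective
        (f := fun k => (y α k, if v α (y α k) = 0 then 1 else 0)) ?_).mono ?_
      · intro k l h
        exact hinj (Prod.mk.inj h).1
      · rintro _ ⟨k, rfl⟩
        refine ⟨k, rfl, ?_, ?_⟩ <;> dsimp only <;> split_ifs <;> omega)
    (fun α => by
      refine (infinite_range_of_injective (f := fun k => (y α k, v α (y α k))) ?_).mono ?_
      · intro k l h
        exact hinj (Prod.mk.inj h).1
      · rintro _ ⟨k, rfl⟩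
        exact ⟨k, rfl, rfl⟩)
    (fun α β hαβ => by
      refine ((hyf α β hαβ).biUnion (t := fun k => {y α k} ×ˢ Iic (g (y α k) + 1))
        fun k _ => (finite_singleton _).prod (finite_Iic _)).subset ?_
      rintro ⟨j, i⟩ ⟨⟨k, hk, hi, -⟩, l, hl, -⟩
      dsimp only at hk hl hi
      obtain rfl : k = l := hinj (hk.symm.trans hl)
      exact mem_biUnion (x := k) (show _ = _ from hk.symm.trans hl) ⟨hk, hk ▸ hi⟩)
    (fun α β hαβ => by
      refine ((hyf α β hαβ).image fun k => (y α k, v α (y α k))).subset ?_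
      rintro ⟨j, i⟩ ⟨⟨k, hk, hi⟩, l, hl, -⟩
      dsimp only at hk hl hi
      obtain rfl : k = l := hinj (hk.symm.trans hl)
      exact ⟨k, hk.symm.trans hl, by rw [hi, hk]⟩)
    (fun α β => by
      rcases eq_or_ne α β with rfl | hαβ
      · convert finite_empty
        ext p
        simp only [mem_inter_iff, mem_ofPred_eq, mem_empty_iff_false, iff_false]
        rintro ⟨⟨_, _, _, h⟩, _, _, h'⟩
        exact h h'
      · refine ((hyf α β hαβ).image fun k => (y α k, v β (y α k))).subset ?_
        rintro ⟨j, i⟩ ⟨⟨k, hk, -⟩, l, hl, hi⟩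
        dsimp only at hk hl hi
        obtain rfl : k = l := hinj (hk.symm.trans hl)
        exact ⟨k, hk.symm.trans hl, by rw [hi, hk]⟩)
  classical
  refine ⟨fun j => if h : ∃ i, i ≤ g j + 1 ∧ (j, i) ∈ M then h.choose else 0, fun α => ?_⟩
  have hgood : ∀ᶠ k in atTop, ∀ i, i ≤ g (y α k) + 1 → (y α k, i) ∈ M → i = v α (y α k) := by
    have hfin : {k | ∃ i, i ≤ g (y α k) + 1 ∧ (y α k, i) ∈ M ∧ i ≠ v α (y α k)}.Finite := by
      refine Finite.of_finite_image (f := y α) (((hMb α).image Prod.fst).subset ?_)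
        (fun k _ l _ h => hinj h)
      rintro _ ⟨k, ⟨i, hi, hM, hne⟩, rfl⟩
      exact ⟨(y α k, i), ⟨⟨k, rfl, hi, hne⟩, hM⟩, rfl⟩
    have := hfin.eventually_cofinite_notMem
    rw [Nat.cofinite_eq_atTop] at this
    filter_upwards [this] with k hk i hi hM
    by_contra hne
    exact hk ⟨i, hi, hM, hne⟩
  have hfreq : ∃ᶠ k in atTop, (y α k, v α (y α k)) ∈ M := by
    rw [Nat.frequently_atTop_iff_infinite]
    intro hfin
    refine hMc α ((hfin.image fun k => (y α k, v α (y α k))).subset ?_)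
    rintro ⟨j, i⟩ ⟨⟨k, hk, hi⟩, hM⟩
    dsimp only at hk hi
    subst hk
    subst hi
    exact ⟨k, hM, rfl⟩
  refine (hyt α).frequently ((hfreq.and_eventually
    (hgood.and ((hyt α).eventually (hg α)))).mono ?_)
  rintro k ⟨hM, hk, hle⟩
  have h : ∃ i, i ≤ g (y α k) + 1 ∧ (y α k, i) ∈ M := ⟨_, by omega, hM⟩
  refine (dif_pos h).trans ?_
  exact hk _ h.choose_spec.1 h.choose_spec.2

/-- Finitely many values of a function at a time can be guessed simultaneously. -/
theorem AllSemiNormal.exists_frequently_eqOn (hN : AllSemiNormal N) (hι : #ι = Cardinal.aleph 1)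
    (r : ℕ → ℕ) (w : ι → ℕ → ℕ → ℕ) :
    ∃ p : ℕ → ℕ → ℕ, ∀ α, ∃ᶠ j in atTop, ∀ i < r j, p j i = w α j i := by
  obtain ⟨p, hp⟩ := hN.exists_frequently_eq hι
    fun α j => Encodable.encode ((List.range (r j)).map (w α j))
  refine ⟨fun j i => ((Encodable.decode (α := List ℕ) (p j)).getD []).getD i 0,
    fun α => (hp α).mono fun j hj i hi => ?_⟩
  simp [hj, hi]

end Separation

theorem exists_countable_piBase (X : Type*) [TopologicalSpace X] [SecondCountableTopology X]
    [Nonempty X] : ∃ O : ℕ → Set X, (∀ i, IsOpen (O i)) ∧ (∀ i, (O i).Nonempty) ∧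
      ∀ U : Set X, IsOpen U → U.Nonempty → ∃ i, O i ⊆ U := by
  have hB := TopologicalSpace.isBasis_countableBasis X
  have hne : (TopologicalSpace.countableBasis X).Nonempty := by
    obtain ⟨x⟩ := ‹Nonempty X›
    obtain ⟨s, hs, -⟩ := hB.exists_subset_of_mem_open (mem_univ x) isOpen_univ
    exact ⟨s, hs⟩
  obtain ⟨O, hO⟩ := (TopologicalSpace.countable_countableBasis X).exists_eq_range hne
  have hmem : ∀ i, O i ∈ TopologicalSpace.countableBasis X := fun i => hO ▸ mem_range_self i
  refine ⟨O, fun i => hB.isOpen (hmem i),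
    fun i => TopologicalSpace.nonempty_of_mem_countableBasis (hmem i), fun U hU ⟨x, hx⟩ => ?_⟩
  obtain ⟨s, hs, -, hsU⟩ := hB.exists_subset_of_mem_open hx hU
  rw [hO] at hs
  obtain ⟨i, rfl⟩ := hs
  exact ⟨i, hsU⟩

theorem IsMeagre.exists_antitone_dense_open {X : Type*} [TopologicalSpace X] {s : Set X}
    (hs : IsMeagre s) : ∃ U : ℕ → Set X, Antitone U ∧ (∀ k, IsOpen (U k)) ∧ (∀ k, Dense (U k)) ∧
      Disjoint s (⋂ k, U k) := by
  obtain ⟨S, hSo, hSd, hSc, hSs⟩ := mem_residual_iff.1 hs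
  obtain ⟨f, hf⟩ := (hSc.insert univ).exists_eq_range (insert_nonempty _ _)
  have hfS : ∀ i, IsOpen (f i) ∧ Dense (f i) := by
    intro i
    rcases (hf ▸ mem_range_self i : f i ∈ insert univ S) with h | h
    · rw [h]
      exact ⟨isOpen_univ, dense_univ⟩
    · exact ⟨hSo _ h, hSd _ h⟩
  have hfin : ∀ k, (f '' Iic k).Finite := fun k => (finite_Iic k).image f
  refine ⟨fun k => ⋂₀ (f '' Iic k), fun k l hkl => sInter_subset_sInter (image_mono
    (Iic_subset_Iic.2 hkl)), fun k => (hfin k).isOpen_sInter ?_, fun k => (hfin k).dense_sInter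
    ?_ ?_, disjoint_left.2 fun x hxs hx => hSs (fun u hu => ?_) hxs⟩
  · rintro _ ⟨i, -, rfl⟩
    exact (hfS i).1
  · rintro _ ⟨i, -, rfl⟩
    exact (hfS i).1
  · rintro _ ⟨i, -, rfl⟩
    exact (hfS i).2
  · obtain ⟨i, rfl⟩ : u ∈ range f := hf ▸ mem_insert_of_mem _ hu
    exact mem_iInter.1 hx i _ ⟨i, mem_Iic.2 le_rfl, rfl⟩

/-- If all almost disjoint families of size `ℵ₁` are semi-normal, then unions of `ℵ₁` meagre sets
are meagre. -/
theorem AllSemiNormal.isMeagre_iUnion {N : Type u} [Countable N] [Infinite N]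
    (hN : AllSemiNormal N) {ι : Type} (hι : #ι = Cardinal.aleph 1) {X : Type*} [TopologicalSpace X]
    [SecondCountableTopology X] [Nonempty X] (s : ι → Set X) (hs : ∀ α, IsMeagre (s α)) :
    IsMeagre (⋃ α, s α) := by
  obtain ⟨O, hOo, hOn, hO⟩ := exists_countable_piBase X
  choose U hUa hUo hUd hU using fun α => (hs α).exists_antitone_dense_open
  have hτ : ∀ α k i, ∃ i', O i' ⊆ O i ∩ U α k := fun α k i =>
    hO _ ((hOo i).inter (hUo α k)) ((hUd α k).inter_open_nonempty _ (hOo i) (hOn i))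
  choose τ hτ using hτ
  obtain ⟨E, hE⟩ := hN.exists_bound hι fun α k => (Finset.range k).sup (τ α k)
  let r : ℕ → ℕ := fun j => Nat.rec 0 (fun _ a => max a (E a) + 1) j
  have hr : ∀ j, r (j + 1) = max (r j) (E (r j)) + 1 := fun j => rfl
  have hrm : StrictMono r := strictMono_nat_of_lt_succ fun j => by rw [hr]; omega
  obtain ⟨p, hp⟩ := hN.exists_frequently_eqOn hι r fun α j => τ α (r j)
  classical
  let μ : ℕ → ℕ → ℕ := fun j i => if O (p j i) ⊆ O i ∧ p j i < r (j + 1) then p j i else i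
  have hμO : ∀ j i, O (μ j i) ⊆ O i := by
    intro j i
    simp only [μ]
    split_ifs with h
    · exact h.1
    · rfl
  have hμr : ∀ j i, i < r j → μ j i < r (j + 1) := by
    intro j i hi
    simp only [μ]
    split_ifs with h
    · exact h.2
    · exact hi.trans (hrm j.lt_succ_self)
  have hμ : ∀ α, ∃ᶠ j in atTop, ∀ i < r j, O (μ j i) ⊆ U α (r j) := by
    intro α
    refine ((hp α).and_eventually (hrm.tendsto_atTop.eventually (hE α))).mono ?_
    rintro j ⟨hj, hjE⟩ i hi
    have hlt : p j i < r (j + 1) := by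
      have := Finset.le_sup (f := τ α (r j)) (Finset.mem_range.2 hi)
      rw [hj i hi, hr]
      omega
    have hsub := hτ α (r j) i
    rw [← hj i hi] at hsub
    have : μ j i = p j i := if_pos ⟨hsub.trans inter_subset_left, hlt⟩
    rw [this]
    exact hsub.trans inter_subset_right
  have hd : ∀ α m, ∃ d, ∃ j, m ≤ j ∧ j < m + d ∧ ∀ i < r j, O (μ j i) ⊆ U α (r j) := by
    intro α m
    obtain ⟨j, hmj, hj⟩ := frequently_atTop.1 (hμ α) m
    exact ⟨j + 1, j, hmj, by omega, hj⟩
  choose d hd using hd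
  obtain ⟨D, hD⟩ := hN.exists_bound hι d
  -- the position reached from `i` by following the moves `m`, `m + 1`, …, `m + n - 1`
  let t : ℕ → ℕ → ℕ → ℕ := fun m i n => Nat.rec i (fun n a => μ (m + n) a) n
  have ht : ∀ m i n, t m i (n + 1) = μ (m + n) (t m i n) := fun m i n => rfl
  have htr : ∀ m i n, i < r m → t m i n < r (m + n) := by
    intro m i n hi
    induction n with
    | zero => exact hi
    | succ n ih => rw [ht]; exact hμr _ _ ih
  have htO : ∀ m i, Antitone fun n => O (t m i n) := fun m i =>
    antitone_nat_of_succ_le fun n => by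
      rw [ht]
      exact hμO _ _
  let W : ℕ → Set X := fun q => ⋃ m ≥ q, ⋃ i < r m, O (t m i (D m))
  have hWo : ∀ q, IsOpen (W q) := fun q =>
    isOpen_biUnion fun m _ => isOpen_biUnion fun i _ => hOo _
  have hWd : ∀ q, Dense (W q) := by
    intro q
    rw [dense_iff_inter_open]
    intro V hV hVn
    obtain ⟨i, hi⟩ := hO V hV hVn
    obtain ⟨x, hx⟩ := hOn (t (max q (i + 1)) i (D (max q (i + 1))))
    refine ⟨x, hi (htO _ _ (Nat.zero_le _) hx), ?_⟩
    refine mem_iUnion₂.2 ⟨max q (i + 1), le_max_left _ _, mem_iUnion₂.2 ⟨i, ?_, hx⟩⟩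
    exact (Nat.lt_of_succ_le (le_max_right q (i + 1))).trans_le (hrm.le_apply)
  have hres : ⋂ q, W q ∈ residual X := by
    rw [countable_iInter_mem]
    exact fun q => residual_of_dense_open (hWo q) (hWd q)
  refine mem_of_superset hres fun x hx hxs => ?_
  obtain ⟨α, hα⟩ := mem_iUnion.1 hxs
  refine disjoint_left.1 (hU α) hα (mem_iInter.2 fun k => ?_)
  obtain ⟨m₀, hm₀⟩ := eventually_atTop.1 (hD α)
  obtain ⟨m, hm, hxm⟩ := mem_iUnion₂.1 (mem_iInter.1 hx (max k m₀))
  obtain ⟨i, hi, hxi⟩ := mem_iUnion₂.1 hxm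
  obtain ⟨j, hmj, hjd, hj⟩ := hd α m
  obtain ⟨n, rfl⟩ := Nat.exists_eq_add_of_le hmj
  have hn : n + 1 ≤ D m := by
    have := hm₀ m ((le_max_right _ _).trans hm)
    omega
  have hxn := htO m i hn hxi
  simp only [ht] at hxn
  refine hUa α ?_ (hj _ (htr m i n hi) hxn)
  exact ((le_max_left _ _).trans hm).trans (hmj.trans hrm.le_apply)

theorem corollary5p7 (N : Type u) [Countable N] [Infinite N]
    (hadd : addMeagre = Cardinal.aleph 1) :
    ∃ A : Set (Set N), IsAlmostDisjointFamily A ∧ #A = Cardinal.aleph 1 ∧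
      ¬ IsSemiNormal (PsiSpace A) := by
  by_contra! hcon
  have hN : AllSemiNormal N := hcon
  have hne : {κ | ∃ S : Set (Set ℝ), (∀ s ∈ S, IsMeagre s) ∧ ¬ IsMeagre (⋃₀ S) ∧
      #S = κ}.Nonempty := by
    by_contra h
    rw [not_nonempty_iff_eq_empty] at h
    rw [addMeagre, h, Cardinal.sInf_empty] at hadd
    exact (Cardinal.aleph_pos 1).ne hadd
  obtain ⟨S, hS, hSU, hcard⟩ := csInf_mem hne
  rw [← addMeagre, hadd] at hcard
  refine hSU ?_
  rw [sUnion_eq_iUnion]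
  exact hN.isMeagre_iUnion hcard _ fun s => hS s s.2
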